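/- **Language.** Fix a signature of predicate symbols of arbitrary finite arities, with no function symbols or constants, and variables $x_0,x_1,\dots$. Formulas are built from atoms $P(x_{n_1},\dots,x_{n_k})$ and $\bot$ by $\wedge,\vee,\to,\forall x_n,\exists x_n,\bigcirc$; $\neg\varphi:=\varphi\to\bot$. **Logics.** $\mathbf{QIEL}^-_-$ is the least set of formulas that contains all instances of the Hilbert axioms of intuitionistic propositional logic, of $\varphi\to\bigcirc\varphi$, of $\varphi\wedge\bigcirc\psi\to\bigcirc(\varphi\wedge\psi)$, and of $\forall x\,\varphi\to\varphi(t/x)$ and $\varphi(t/x)\to\exists x\,\varphi$ ($t$ a variable free for $x$ in $\varphi$), and is closed under modus ponens, the Bernays rules (from $\varphi\to\psi$ infer $\varphi\to\forall x\,\psi$, and from $\psi\to\varphi$ infer $\exists x\,\psi\to\varphi$, where $x$ is not free in $\varphi$) and $\bigcirc$-monotonicity (from $\varphi\to\psi$ infer $\bigcirc\varphi\to\bigcirc\psi$). $\mathbf{QIEL}^-$ is obtained by adding the axioms $\bigcirc(\varphi\to\psi)\to(\bigcirc\varphi\to\bigcirc\psi)$, and $\mathbf{QIEL}$ by adding moreover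 $\neg\bigcirc\bot$. **Cover systems.** A *strictly localic cover system* is a poset $(S,\le)$ with a relation $x\triangleright C$ between points $x\in S$ and sets $C\subseteq S$ ("$C$ is an $x$-cover") such that: every $x$ has a cover $C\subseteq{\uparrow}x$; if $x\triangleright C$ and $y\triangleright C_y$ for every $y\in C$, then $x\triangleright\bigcup_{y\in C}C_y$; if $x\le y$ and $x\triangleright C$, then $y\triangleright C'$ for some $C'\subseteq{\uparrow}C$; and every $x$-cover is included in ${\uparrow}x$. Put $jX=\{x:\exists C\ (x\triangleright C\subseteq X)\}$. A *proposition* is an up-set $X$ with $jX\subseteq X$. A *modal cover system* has moreover a binary relation $R$ on $S$ such that, with $\langle R\rangle A=\{x:\exists y\in A\ xRy\}$: if $x\le y$ and $xRz$, then $yRw$ and $z\le w$ for some $w$; and, for every $A\subseteq S$, if $x\in j\langle R\rangle A$, then $xRy$ for some $y\in jA$. Consider the condition $(*)$ if $xRy$, then there is $z$ with $x\le z$, $y\le z$ and $xRz$. The system is *prenuclear* if $R$ is reflexive and $(*)$ holds; *multiplicative prenuclear* if $R$ is serial, $(*)$ holds, and $xRy$, $xRz$ imply that there is $w$ with $y\le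 w$, $z\le w$ and $xRw$; an *$\mathbf{IEL}$-cover system* if it is multiplicative prenuclear and $xRy$, $y\triangleright\emptyset$ imply $x\triangleright\emptyset$. **Models.** A cover model consists of a modal cover system, a non-empty set $D$, and a valuation that assigns to each $k$-ary predicate symbol $P$ a function $V(P)$ from $D^k$ to propositions. For an assignment $\sigma:\mathbb N\to D$ and $x\in S$, truth is defined by: - $x,\sigma\Vdash P(x_{n_1},\dots,x_{n_k})$ iff $x\in V(P)(\sigma_{n_1},\dots,\sigma_{n_k})$; - $x,\sigma\Vdash\bot$ iff $x\triangleright\emptyset$; - $x,\sigma\Vdash\varphi\wedge\psi$ iff $x,\sigma\Vdash\varphi$ and $x,\sigma\Vdash\psi$; - $x,\sigma\Vdash\varphi\vee\psi$ iff there is $x\triangleright C$ such that for each $y\in C$, $y,\sigma\Vdash\varphi$ or $y,\sigma\Vdash\psi$; - $x,\sigma\Vdash\varphi\to\psi$ iff for all $y\ge x$, $y,\sigma\Vdash\varphi$ implies $y,\sigma\Vdash\psi$; - $x,\sigma\Vdash\forall x_n\varphi$ iff $x,\sigma(d/n)\Vdash\varphi$ for all $d\in D$; - $x,\sigma\Vdash\exists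 x_n\varphi$ iff there is $x\triangleright C$ such that for each $y\in C$ there is $d\in D$ with $y,\sigma(d/n)\Vdash\varphi$; - $x,\sigma\Vdash\bigcirc\varphi$ iff there is $y$ with $xRy$ and $y,\sigma\Vdash\varphi$. **Theorem.** For every formula $\varphi$: $\mathbf{QIEL}^-_-\vdash\varphi$ (respectively $\mathbf{QIEL}^-\vdash\varphi$, $\mathbf{QIEL}\vdash\varphi$) if and only if $\varphi$ is true, at all points and under all assignments, in every cover model on a prenuclear (respectively multiplicative prenuclear, $\mathbf{IEL}$-) cover system. -/

import Mathlib

universe u v w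

/-! ### Syntax: one-sorted predicate modal language, no function symbols, no constants -/

/-- Formulas over a signature with the set `Pred k` of `k`-ary predicate symbols.
The individual variables are `x₀, x₁, …`; the variable `xₙ` is represented by its index `n`. -/
inductive QFormula (Pred : ℕ → Type u) : Type u
  | atom {k : ℕ} (p : Pred k) (t : Fin k → ℕ) : QFormula Pred
  | bot : QFormula Pred
  | and (φ ψ : QFormula Pred) : QFormula Pred
  | or (φ ψ : QFormula Pred) : QFormula Pred
  | imp (φ ψ : QFormula Pred) : QFormula Pred
  | all (n : ℕ) (φ : QFormula Pred) : QFormula Pred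
  | ex (n : ℕ) (φ : QFormula Pred) : QFormula Pred
  | circ (φ : QFormula Pred) : QFormula Pred

namespace QFormula

variable {Pred : ℕ → Type u}

/-- Negation `¬φ := φ → ⊥`. -/
def neg (φ : QFormula Pred) : QFormula Pred := imp φ bot

/-- The set of free variables. -/
def fv : QFormula Pred → Finset ℕ
  | atom _ t => Finset.univ.image t
  | bot => ∅
  | and φ ψ => φ.fv ∪ ψ.fv
  | or φ ψ => φ.fv ∪ ψ.fv
  | imp φ ψ => φ.fv ∪ ψ.fv
  | all n φ => φ.fv.erase n
  | ex n φ => φ.fv.erase n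
  | circ φ => φ.fv

/-- `φ.subst t x` is `φ(t/x)`: every free occurrence of the variable `x` is replaced by the
variable `t` (the only terms are variables). It is used only when `t` is free for `x` in `φ`. -/
def subst (t x : ℕ) : QFormula Pred → QFormula Pred
  | atom p s => atom p (fun i => if s i = x then t else s i)
  | bot => bot
  | and φ ψ => and (subst t x φ) (subst t x ψ)
  | or φ ψ => or (subst t x φ) (subst t x ψ)
  | imp φ ψ => imp (subst t x φ) (subst t x ψ)
  | all n φ => if n = x then all n φ else all n (subst t x φ)
  | ex n φ => if n = x then ex n φ else ex n (subst t x φ)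
  | circ φ => circ (subst t x φ)

/-- `t` is free for `x` in `φ`: no free occurrence of `x` in `φ` lies in the scope of a quantifier
that binds `t`. -/
def FreeFor (t x : ℕ) : QFormula Pred → Prop
  | atom _ _ => True
  | bot => True
  | and φ ψ => FreeFor t x φ ∧ FreeFor t x ψ
  | or φ ψ => FreeFor t x φ ∧ FreeFor t x ψ
  | imp φ ψ => FreeFor t x φ ∧ FreeFor t x ψ
  | all n φ => x ∉ (all n φ).fv ∨ (n ≠ t ∧ FreeFor t x φ)
  | ex n φ => x ∉ (ex n φ).fv ∨ (n ≠ t ∧ FreeFor t x φ)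
  | circ φ => FreeFor t x φ

end QFormula

/-! ### The logics -/

open QFormula in
/-- Derivability in the extension of the basic quantified logic (intuitionistic predicate logic
with `φ → ○φ`, `φ ∧ ○ψ → ○(φ ∧ ψ)` and the `○`-monotonicity rule) by a set `Ax` of further
axioms. -/
inductive QDerivable {Pred : ℕ → Type u} (Ax : Set (QFormula Pred)) : QFormula Pred → Prop
  | extra {φ} : φ ∈ Ax → QDerivable Ax φ
  | ax_s (φ ψ θ) : QDerivable Ax (imp (imp φ (imp ψ θ)) (imp (imp φ ψ) (imp φ θ)))
  | ax_k (φ ψ) : QDerivable Ax (imp φ (imp ψ φ))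
  | and_intro (φ ψ) : QDerivable Ax (imp φ (imp ψ (and φ ψ)))
  | and_left (φ ψ) : QDerivable Ax (imp (and φ ψ) φ)
  | and_right (φ ψ) : QDerivable Ax (imp (and φ ψ) ψ)
  | or_elim (φ ψ θ) : QDerivable Ax (imp (imp φ θ) (imp (imp ψ θ) (imp (or φ ψ) θ)))
  | or_left (φ ψ) : QDerivable Ax (imp φ (or φ ψ))
  | or_right (φ ψ) : QDerivable Ax (imp ψ (or φ ψ))
  | bot_elim (φ) : QDerivable Ax (imp bot φ)
  | circ_refl (φ) : QDerivable Ax (imp φ (circ φ))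
  | circ_strength (φ ψ) : QDerivable Ax (imp (and φ (circ ψ)) (circ (and φ ψ)))
  | all_inst (φ) (t x : ℕ) : FreeFor t x φ → QDerivable Ax (imp (all x φ) (subst t x φ))
  | ex_inst (φ) (t x : ℕ) : FreeFor t x φ → QDerivable Ax (imp (subst t x φ) (ex x φ))
  | mp {φ ψ} : QDerivable Ax (imp φ ψ) → QDerivable Ax φ → QDerivable Ax ψ
  | bernays_all {φ ψ} (x : ℕ) : x ∉ φ.fv → QDerivable Ax (imp φ ψ) →
      QDerivable Ax (imp φ (all x ψ))
  | bernays_ex {φ ψ} (x : ℕ) : x ∉ φ.fv → QDerivable Ax (imp ψ φ) →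
      QDerivable Ax (imp (ex x ψ) φ)
  | circ_mono {φ ψ} : QDerivable Ax (imp φ ψ) → QDerivable Ax (imp (circ φ) (circ ψ))

/-- Names of the three propositional logics `IEL⁻₋`, `IEL⁻` and `IEL`. -/
inductive IELLogic
  | IELmm
  | IELm
  | IEL

/-- The instances of `○(φ → ψ) → (○φ → ○ψ)`. -/
def axiomsK (Pred : ℕ → Type u) : Set (QFormula Pred) :=
  {χ | ∃ φ ψ : QFormula Pred, χ = .imp (.circ (.imp φ ψ)) (.imp (.circ φ) (.circ ψ))}

/-- The axioms that are added to the basic system: none for `QIEL⁻₋`, the `K`-axioms for `QIEL⁻`,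
the `K`-axioms and `¬○⊥` for `QIEL`. -/
def IELLogic.extraAxioms (Pred : ℕ → Type u) : IELLogic → Set (QFormula Pred)
  | .IELmm => ∅
  | .IELm => axiomsK Pred
  | .IEL => axiomsK Pred ∪ {QFormula.neg (.circ .bot)}

/-- `φ` is a theorem of the quantified logic `QL`. -/
def IELLogic.QProvable {Pred : ℕ → Type u} (L : IELLogic) (φ : QFormula Pred) : Prop :=
  QDerivable (L.extraAxioms Pred) φ

/-! ### Cover systems -/

/-- A cover system on a poset; `covers x C` is `x ▷ C`, and `↑C` is `upperClosure C`. -/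
structure CoverSystem (S : Type v) [PartialOrder S] where
  covers : S → Set S → Prop
  existence : ∀ x, ∃ C, covers x C ∧ C ⊆ Set.Ici x
  transitivity : ∀ (x : S) (C : Set S) (E : S → Set S), covers x C →
    (∀ y ∈ C, covers y (E y)) → covers x (⋃ y ∈ C, E y)
  refinement : ∀ (x y : S) (C : Set S), x ≤ y → covers x C →
    ∃ C', covers y C' ∧ C' ⊆ (upperClosure C : Set S)

namespace CoverSystem

variable {S : Type v} [PartialOrder S]

/-- The local members of `X`: `j X = {x | ∃ C, x ▷ C ⊆ X}`. -/
def j (𝒮 : CoverSystem S) (X : Set S) : Set S := {x | ∃ C, 𝒮.covers x C ∧ C ⊆ X}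

/-- A proposition is a localised up-set. -/
def IsProposition (𝒮 : CoverSystem S) (X : Set S) : Prop := IsUpperSet X ∧ 𝒮.j X ⊆ X

/-- Every `x`-cover is included in `↑x`. -/
def StrictlyLocalic (𝒮 : CoverSystem S) : Prop := ∀ x C, 𝒮.covers x C → C ⊆ Set.Ici x

end CoverSystem

/-- The operator `⟨R⟩ A = R⁻¹(A)`. -/
def relDiamond {S : Type v} (R : S → S → Prop) (A : Set S) : Set S := {x | ∃ y ∈ A, R x y}

/-- Modal cover systems: strictly localic cover systems with a relation `R` subject to confluence
and modal localisation. -/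
structure ModalCoverSystem (S : Type v) [PartialOrder S] extends CoverSystem S where
  strictlyLocalic : toCoverSystem.StrictlyLocalic
  R : S → S → Prop
  confluence : ∀ x y z, x ≤ y → R x z → ∃ w, R y w ∧ z ≤ w
  modal_localisation : ∀ (x : S) (A : Set S), x ∈ toCoverSystem.j (relDiamond R A) →
    ∃ y, R x y ∧ y ∈ toCoverSystem.j A

namespace ModalCoverSystem

variable {S : Type v} [PartialOrder S]

/-- If `x R y`, then there is `z ∈ ↑y` with `x ≤ z` and `x R z`. -/
def PrenuclearCondition (ℳ : ModalCoverSystem S) : Prop :=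
  ∀ x y, ℳ.R x y → ∃ z, y ≤ z ∧ x ≤ z ∧ ℳ.R x z

/-- Prenuclear cover systems. -/
def IsPrenuclear (ℳ : ModalCoverSystem S) : Prop :=
  (∀ x, ℳ.R x x) ∧ ℳ.PrenuclearCondition

/-- Multiplicative prenuclear cover systems. -/
def IsMultiplicativePrenuclear (ℳ : ModalCoverSystem S) : Prop :=
  (∀ x, ∃ y, ℳ.R x y) ∧
  (∀ x y z, ℳ.R x y → ℳ.R x z → ∃ w, y ≤ w ∧ z ≤ w ∧ ℳ.R x w) ∧
  ℳ.PrenuclearCondition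

/-- `IEL`-cover systems. -/
def IsIEL (ℳ : ModalCoverSystem S) : Prop :=
  ℳ.IsMultiplicativePrenuclear ∧ ∀ x y, ℳ.R x y → ℳ.covers y ∅ → ℳ.covers x ∅

end ModalCoverSystem

/-- The class of cover systems that belongs to each logic. -/
def IELLogic.IsCoverSystemFor (L : IELLogic) {S : Type v} [PartialOrder S]
    (ℳ : ModalCoverSystem S) : Prop :=
  match L with
  | .IELmm => ℳ.IsPrenuclear
  | .IELm => ℳ.IsMultiplicativePrenuclear
  | .IEL => ℳ.IsIEL

/-! ### Models -/

/-- A valuation with domain `D` maps a `k`-ary predicate symbol to a function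
`D^k → Prop(𝒮)`. -/
structure CoverValuation (Pred : ℕ → Type u) {S : Type v} [PartialOrder S] (𝒮 : CoverSystem S)
    (D : Type w) where
  val : ∀ {k : ℕ}, Pred k → (Fin k → D) → Set S
  isProposition : ∀ {k : ℕ} (p : Pred k) (a : Fin k → D), 𝒮.IsProposition (val p a)

/-- Truth of a formula at a point `x` of a cover model under an assignment `σ : ℕ → D`. -/
def CoverForces {Pred : ℕ → Type u} {S : Type v} [PartialOrder S] (ℳ : ModalCoverSystem S)
    {D : Type w} (V : CoverValuation Pred ℳ.toCoverSystem D) :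
    (ℕ → D) → S → QFormula Pred → Prop
  | σ, x, .atom p t => x ∈ V.val p (fun i => σ (t i))
  | _, x, .bot => ℳ.covers x ∅
  | σ, x, .and φ ψ => CoverForces ℳ V σ x φ ∧ CoverForces ℳ V σ x ψ
  | σ, x, .or φ ψ =>
      ∃ C, ℳ.covers x C ∧ ∀ y ∈ C, CoverForces ℳ V σ y φ ∨ CoverForces ℳ V σ y ψ
  | σ, x, .imp φ ψ => ∀ y, x ≤ y → CoverForces ℳ V σ y φ → CoverForces ℳ V σ y ψ
  | σ, x, .all n φ => ∀ d : D, CoverForces ℳ V (Function.update σ n d) x φ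
  | σ, x, .ex n φ =>
      ∃ C, ℳ.covers x C ∧ ∀ y ∈ C, ∃ d : D, CoverForces ℳ V (Function.update σ n d) y φ
  | σ, x, .circ φ => x ∈ relDiamond ℳ.R {y | CoverForces ℳ V σ y φ}

/-- `φ` is true in every model on a cover system of the class that belongs to `L` (with points in
`Type b` and individuals in `Type c`): at all points and under all assignments. -/
def IELLogic.CoverValid.{a, b, c} {Pred : ℕ → Type a} (L : IELLogic) (φ : QFormula Pred) : Prop :=
  ∀ (S : Type b) [PartialOrder S] (ℳ : ModalCoverSystem S), L.IsCoverSystemFor ℳ →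
    ∀ (D : Type c) [Nonempty D] (V : CoverValuation Pred ℳ.toCoverSystem D)
      (σ : ℕ → D) (x : S), CoverForces ℳ V σ x φ

/-!
Soundness is an induction on derivations. Truth sets are localised up-sets (`isProposition_forces`),
and a substitution acts on truth as a change of the assignment (`forces_subst`).

Completeness uses one canonical model for each formula. Write `a ⊢ b` when `a → b` is derivable.
The points are the sets `T` of formulas that are closed in the sense of the Dedekind–MacNeille
completion: `T` contains every formula that is entailed by each single formula entailing all of `T`
(`CutTheory`). They are ordered by inclusion, `T` is covered by `C` when `T = ⋂ C`, and `T R U`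
means that `T` contains each `ψ` with `○ a ⊢ ψ` for all `a` that entail `U`. The points form the
order dual of the MacNeille completion of the Lindenbaum algebra, and `R` encodes the least
extension of `○` to it. Working with the completion, and not with the Lindenbaum algebra itself, is
what makes modal localisation hold: the successors that are chosen locally can be intersected.
The frame conditions for `R` all follow by the same device: a property of the formulas in a theory
`T` is tested on a formula `a` that entails `T`, and `a` is moved across `⊢` by residuation.

A point should force `φ` exactly if it contains `φ`. Given the formula `φ₀` to be refuted, with all
its bound variables below `N`, the individuals are the variables `N, N + 1, …`. An assignment can
then be substituted into any subformula of `φ₀` with no renaming of bound variables (`rename`), as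
an individual is never captured; this gives the truth lemma `canonical_forces_iff`. The universal
quantifier needs that `a ⊢ φ(d/n)` for all individuals `d` implies `a ⊢ ∀ n φ`, which follows by
choosing `d` fresh. Finally `φ₀` may be replaced by its universal closure, which `rename` leaves
unchanged.
-/

/-! ### Substitution and truth -/

namespace QFormula

variable {Pred : ℕ → Type u}

theorem subst_eq_self_of_notMem_fv {t x : ℕ} {φ : QFormula Pred} (h : x ∉ φ.fv) :
    subst t x φ = φ := by
  induction φ with
  | atom p s =>
    simp only [fv, Finset.mem_image, Finset.mem_univ, true_and, not_exists] at h
    simp [subst, h]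
  | bot => rfl
  | and φ ψ h₁ h₂ | or φ ψ h₁ h₂ | imp φ ψ h₁ h₂ =>
    simp only [fv, Finset.mem_union, not_or] at h
    simp [subst, h₁ h.1, h₂ h.2]
  | all n φ ih | ex n φ ih =>
    simp only [fv, Finset.mem_erase, not_and'] at h
    by_cases hn : n = x
    · simp [subst, hn]
    · simp only [subst, hn, if_false]
      rw [ih fun hx => h hx (Ne.symm hn)]
  | circ φ ih => simp [subst, ih h]

theorem freeFor_self (x : ℕ) (φ : QFormula Pred) : FreeFor x x φ := by
  induction φ with
  | atom | bot => trivial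
  | and φ ψ h₁ h₂ | or φ ψ h₁ h₂ | imp φ ψ h₁ h₂ => exact ⟨h₁, h₂⟩
  | all n φ ih | ex n φ ih =>
    by_cases hn : n = x
    · left; simp [fv, hn]
    · exact Or.inr ⟨hn, ih⟩
  | circ φ ih => exact ih

theorem subst_self (x : ℕ) (φ : QFormula Pred) : subst x x φ = φ := by
  induction φ with
  | atom p s =>
    simp only [subst, atom.injEq, heq_eq_eq, true_and]
    funext i
    split_ifs with h <;> simp [h]
  | bot => rfl
  | _ => simp_all [subst]

end QFormula

section Soundness

variable {Pred : ℕ → Type u} {S : Type v} [PartialOrder S] (ℳ : ModalCoverSystem S)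
  {D : Type w} (V : CoverValuation Pred ℳ.toCoverSystem D)

theorem forces_congr {φ : QFormula Pred} {σ τ : ℕ → D} {x : S}
    (h : ∀ n ∈ φ.fv, σ n = τ n) : CoverForces ℳ V σ x φ ↔ CoverForces ℳ V τ x φ := by
  induction φ generalizing σ τ x with
  | atom p t =>
    have : (fun i => σ (t i)) = fun i => τ (t i) := by
      funext i
      exact h _ (by simp [QFormula.fv])
    simp only [CoverForces, this]
  | bot => rfl
  | and φ ψ h₁ h₂ | or φ ψ h₁ h₂ | imp φ ψ h₁ h₂ =>
    simp only [QFormula.fv, Finset.mem_union] at h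
    have e₁ := fun y => @h₁ σ τ y fun n hn => h n (Or.inl hn)
    have e₂ := fun y => @h₂ σ τ y fun n hn => h n (Or.inr hn)
    simp only [CoverForces, e₁, e₂]
  | all n φ ih | ex n φ ih =>
    have e : ∀ d y, CoverForces ℳ V (Function.update σ n d) y φ ↔
        CoverForces ℳ V (Function.update τ n d) y φ := by
      refine fun d y => ih fun m hm => ?_
      by_cases hmn : m = n
      · simp [hmn]
      · simp [hmn, h m (by simp [QFormula.fv, hmn, hm])]
    simp only [CoverForces, e]
  | circ φ ih =>
    have e := fun y => @ih σ τ y h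
    simp only [CoverForces, e]

theorem forces_update_of_notMem_fv {φ : QFormula Pred} {n : ℕ} (h : n ∉ φ.fv) {σ : ℕ → D}
    {x : S} {d : D} : CoverForces ℳ V (Function.update σ n d) x φ ↔ CoverForces ℳ V σ x φ :=
  forces_congr ℳ V fun _ hm => Function.update_of_ne (ne_of_mem_of_not_mem hm h) _ _

theorem forces_subst {φ : QFormula Pred} {t x : ℕ} (h : φ.FreeFor t x) {σ : ℕ → D} {y : S} :
    CoverForces ℳ V σ y (φ.subst t x) ↔
      CoverForces ℳ V (Function.update σ x (σ t)) y φ := by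
  induction φ generalizing σ y with
  | atom p s =>
    have : (fun i => σ (if s i = x then t else s i)) =
        fun i => Function.update σ x (σ t) (s i) := by
      funext i
      by_cases hi : s i = x <;> simp [hi]
    simp only [QFormula.subst, CoverForces, this]
  | bot => rfl
  | and φ ψ h₁ h₂ | or φ ψ h₁ h₂ | imp φ ψ h₁ h₂ =>
    have e₁ := fun y => @h₁ h.1 σ y
    have e₂ := fun y => @h₂ h.2 σ y
    simp only [QFormula.subst, CoverForces, e₁, e₂]
  | all n φ ih | ex n φ ih =>
    by_cases hn : n = x
    · subst hn
      simp only [QFormula.subst, if_true, CoverForces, Function.update_idem]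
    · have e : ∀ d y, CoverForces ℳ V (Function.update σ n d) y (φ.subst t x) ↔
          CoverForces ℳ V (Function.update (Function.update σ x (σ t)) n d) y φ := by
        intro d y
        rcases h with h | ⟨hnt, h⟩
        · have hx : x ∉ φ.fv := fun hx => h (by simp [QFormula.fv, hx, Ne.symm hn])
          rw [QFormula.subst_eq_self_of_notMem_fv hx, Function.update_comm (Ne.symm hn),
            forces_update_of_notMem_fv ℳ V hx]
        · rw [ih h, Function.update_comm (Ne.symm hn),
            Function.update_of_ne (Ne.symm hnt)]
      simp only [QFormula.subst, hn, if_false, CoverForces, e]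
  | circ φ ih =>
    have e := fun y => @ih h σ y
    simp only [QFormula.subst, CoverForces, e]

theorem CoverSystem.isUpperSet_j (𝒮 : CoverSystem S) {X : Set S} (hX : IsUpperSet X) :
    IsUpperSet (𝒮.j X) := by
  rintro x y hxy ⟨C, hC, hCX⟩
  obtain ⟨C', hC', hsub⟩ := 𝒮.refinement x y C hxy hC
  refine ⟨C', hC', fun z hz => ?_⟩
  obtain ⟨c, hc, hcz⟩ := hsub hz
  exact hX hcz (hCX hc)

theorem CoverSystem.j_j_subset (𝒮 : CoverSystem S) (X : Set S) : 𝒮.j (𝒮.j X) ⊆ 𝒮.j X := by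
  classical
  rintro x ⟨C, hC, hCX⟩
  choose! E hE hEX using hCX
  refine ⟨_, 𝒮.transitivity x C E hC fun y hy => hE hy, ?_⟩
  simp only [Set.iUnion_subset_iff]
  exact fun y hy => hEX hy

theorem CoverSystem.isProposition_j (𝒮 : CoverSystem S) {X : Set S} (hX : IsUpperSet X) :
    𝒮.IsProposition (𝒮.j X) :=
  ⟨𝒮.isUpperSet_j hX, 𝒮.j_j_subset X⟩

theorem isProposition_forces (φ : QFormula Pred) (σ : ℕ → D) :
    ℳ.toCoverSystem.IsProposition {x | CoverForces ℳ V σ x φ} := by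
  induction φ generalizing σ with
  | atom p t => exact V.isProposition p _
  | bot =>
    convert ℳ.toCoverSystem.isProposition_j isUpperSet_empty using 1
    ext x
    simp [CoverForces, CoverSystem.j, Set.subset_empty_iff]
  | and φ ψ h₁ h₂ =>
    refine ⟨fun x y hxy h => ⟨(h₁ σ).1 hxy h.1, (h₂ σ).1 hxy h.2⟩, ?_⟩
    rintro x ⟨C, hC, hCX⟩
    exact ⟨(h₁ σ).2 ⟨C, hC, fun y hy => (hCX hy).1⟩, (h₂ σ).2 ⟨C, hC, fun y hy => (hCX hy).2⟩⟩
  | or φ ψ h₁ h₂ => exact ℳ.toCoverSystem.isProposition_j ((h₁ σ).1.union (h₂ σ).1)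
  | imp φ ψ h₁ h₂ =>
    refine ⟨fun x y hxy h z hyz => h z (hxy.trans hyz), ?_⟩
    rintro x ⟨C, hC, hCX⟩ y hxy hy
    obtain ⟨C', hC', hsub⟩ := ℳ.refinement x y C hxy hC
    refine (h₂ σ).2 ⟨C', hC', fun z hz => ?_⟩
    obtain ⟨c, hc, hcz⟩ := hsub hz
    exact hCX hc z hcz ((h₁ σ).1 (ℳ.strictlyLocalic y C' hC' hz) hy)
  | all n φ ih =>
    refine ⟨fun x y hxy h d => (ih _).1 hxy (h d), ?_⟩
    rintro x ⟨C, hC, hCX⟩ d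
    exact (ih _).2 ⟨C, hC, fun y hy => hCX hy d⟩
  | ex n φ ih =>
    have : IsUpperSet {y | ∃ d, CoverForces ℳ V (Function.update σ n d) y φ} :=
      fun x y hxy ⟨d, hd⟩ => ⟨d, (ih _).1 hxy hd⟩
    exact ℳ.toCoverSystem.isProposition_j this
  | circ φ ih =>
    refine ⟨?_, ?_⟩
    · rintro x y hxy ⟨z, hz, hxz⟩
      obtain ⟨w, hyw, hzw⟩ := ℳ.confluence x y z hxy hxz
      exact ⟨w, (ih σ).1 hzw hz, hyw⟩
    · intro x hx
      obtain ⟨y, hxy, hy⟩ := ℳ.modal_localisation x _ hx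
      exact ⟨y, (ih σ).2 hy, hxy⟩

variable {V} in
theorem CoverForces.mono {φ : QFormula Pred} {σ : ℕ → D} {x y : S} (hxy : x ≤ y)
    (h : CoverForces ℳ V σ x φ) : CoverForces ℳ V σ y φ :=
  (isProposition_forces ℳ V φ σ).1 hxy h

theorem CoverSystem.subset_j (𝒮 : CoverSystem S) {X : Set S} (hX : IsUpperSet X) :
    X ⊆ 𝒮.j X := by
  intro x hx
  obtain ⟨C, hC, hsub⟩ := 𝒮.existence x
  exact ⟨C, hC, fun y hy => hX (hsub hy) hx⟩

/-- Soundness, uniformly in the extra axioms. Seriality and `PrenuclearCondition` suffice for the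
basic system, as they hold in all three classes of cover systems. -/
theorem QDerivable.sound {Ax : Set (QFormula Pred)} [Nonempty D]
    (hAx : ∀ φ ∈ Ax, ∀ (σ : ℕ → D) x, CoverForces ℳ V σ x φ)
    (hrefl : ∀ x, ∃ y, ℳ.R x y) (hpre : ∀ x y, ℳ.R x y → ∃ z, y ≤ z ∧ x ≤ z ∧ ℳ.R x z)
    {φ : QFormula Pred} (h : QDerivable Ax φ) (σ : ℕ → D) (x : S) :
    CoverForces ℳ V σ x φ := by
  induction h generalizing σ x with
  | extra h => exact hAx _ h σ x
  | ax_s φ ψ θ =>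
    intro y _ h₁ z hyz h₂ w hzw h₃
    exact h₁ w (hyz.trans hzw) h₃ w le_rfl (h₂ w hzw h₃)
  | ax_k φ ψ => exact fun y _ h₁ z hyz _ => h₁.mono ℳ hyz
  | and_intro φ ψ => exact fun y _ h₁ z hyz h₂ => ⟨h₁.mono ℳ hyz, h₂⟩
  | and_left φ ψ => exact fun y _ h => h.1
  | and_right φ ψ => exact fun y _ h => h.2
  | or_elim φ ψ θ =>
    rintro y _ h₁ z hyz h₂ w hzw ⟨C, hC, h₃⟩
    refine (isProposition_forces ℳ V θ σ).2 ⟨C, hC, fun c hc => ?_⟩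
    have hwc := ℳ.strictlyLocalic w C hC hc
    rcases h₃ c hc with h | h
    · exact h₁ c (hyz.trans (hzw.trans hwc)) h
    · exact h₂ c (hzw.trans hwc) h
  | or_left φ ψ =>
    intro y _ h
    obtain ⟨C, hC, hsub⟩ := ℳ.subset_j (isProposition_forces ℳ V φ σ).1 h
    exact ⟨C, hC, fun c hc => Or.inl (hsub hc)⟩
  | or_right φ ψ =>
    intro y _ h
    obtain ⟨C, hC, hsub⟩ := ℳ.subset_j (isProposition_forces ℳ V ψ σ).1 h
    exact ⟨C, hC, fun c hc => Or.inr (hsub hc)⟩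
  | bot_elim φ =>
    exact fun y _ h => (isProposition_forces ℳ V φ σ).2 ⟨∅, h, Set.empty_subset _⟩
  | circ_refl φ =>
    intro y _ h
    obtain ⟨z, hz⟩ := hrefl y
    obtain ⟨w, _, hyw, hw⟩ := hpre y z hz
    exact ⟨w, h.mono ℳ hyw, hw⟩
  | circ_strength φ ψ =>
    rintro y _ ⟨h₁, z, h₂, hyz⟩
    obtain ⟨w, hzw, hyw, hw⟩ := hpre y z hyz
    exact ⟨w, ⟨h₁.mono ℳ hyw, CoverForces.mono ℳ hzw h₂⟩, hw⟩
  | all_inst φ t n hf =>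
    intro y _ h
    exact (forces_subst ℳ V hf).2 (h _)
  | ex_inst φ t n hf =>
    intro y _ h
    rw [forces_subst ℳ V hf] at h
    obtain ⟨C, hC, hsub⟩ := ℳ.subset_j (isProposition_forces ℳ V φ _).1 h
    exact ⟨C, hC, fun c hc => ⟨_, hsub hc⟩⟩
  | mp _ _ h₁ h₂ => exact h₁ σ x x le_rfl (h₂ σ x)
  | bernays_all n hn _ ih =>
    intro y _ h d
    exact ih _ y y le_rfl ((forces_update_of_notMem_fv ℳ V hn).2 h)
  | @bernays_ex φ ψ n hn _ ih =>
    rintro y _ ⟨C, hC, h⟩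
    refine (isProposition_forces ℳ V φ σ).2 ⟨C, hC, fun c hc => ?_⟩
    obtain ⟨d, hd⟩ := h c hc
    exact (forces_update_of_notMem_fv ℳ V hn).1 (ih _ c c le_rfl hd)
  | circ_mono _ ih =>
    rintro y _ ⟨z, hz, hyz⟩
    exact ⟨z, ih σ z z le_rfl hz, hyz⟩

end Soundness

theorem forces_axiomsK {Pred : ℕ → Type u} {S : Type v} [PartialOrder S]
    (ℳ : ModalCoverSystem S) {D : Type w} (V : CoverValuation Pred ℳ.toCoverSystem D)
    (h : ∀ x y z, ℳ.R x y → ℳ.R x z → ∃ w, y ≤ w ∧ z ≤ w ∧ ℳ.R x w)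
    {χ : QFormula Pred} (hχ : χ ∈ axiomsK Pred) (σ : ℕ → D) (x : S) :
    CoverForces ℳ V σ x χ := by
  obtain ⟨φ, ψ, rfl⟩ := hχ
  rintro y _ ⟨z, hz, hyz⟩ w hyw ⟨v, hv, hwv⟩
  obtain ⟨z', hwz', hzz'⟩ := ℳ.confluence y w z hyw hyz
  obtain ⟨u, hu₁, hu₂, hwu⟩ := h w z' v hwz' hwv
  exact ⟨u, hz u (hzz'.trans hu₁) (CoverForces.mono ℳ hu₂ hv), hwu⟩

theorem IELLogic.QProvable.coverValid {Pred : ℕ → Type u} {L : IELLogic} {φ : QFormula Pred}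
    (h : L.QProvable φ) : IELLogic.CoverValid.{u, v, w} L φ := by
  intro S _ ℳ hℳ D _ V σ x
  cases L with
  | IELmm => exact h.sound ℳ V (by simp [extraAxioms]) (fun x => ⟨x, hℳ.1 x⟩) hℳ.2 σ x
  | IELm => exact h.sound ℳ V (fun χ hχ => forces_axiomsK ℳ V hℳ.2.1 hχ) hℳ.1 hℳ.2.2 σ x
  | IEL =>
    refine h.sound ℳ V ?_ hℳ.1.1 hℳ.1.2.2 σ x
    rintro χ (hχ | rfl) σ x
    · exact forces_axiomsK ℳ V hℳ.1.2.1 hχ σ x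
    · rintro y _ ⟨z, hz, hyz⟩
      exact hℳ.2 y z hyz hz

/-! ### The Lindenbaum preorder -/

/-- Derivability of the implication, the preorder underlying the Lindenbaum algebra. -/
def Entails {Pred : ℕ → Type u} (Ax : Set (QFormula Pred)) (φ ψ : QFormula Pred) : Prop :=
  QDerivable Ax (.imp φ ψ)

namespace Entails

open QFormula

variable {Pred : ℕ → Type u} {Ax : Set (QFormula Pred)} {a b c : QFormula Pred}

theorem of_derivable (h : QDerivable Ax b) : Entails Ax a b := (QDerivable.ax_k _ _).mp h

theorem mp (h₁ : Entails Ax a (.imp b c)) (h₂ : Entails Ax a b) : Entails Ax a c :=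
  ((QDerivable.ax_s _ _ _).mp h₁).mp h₂

theorem refl (a : QFormula Pred) : Entails Ax a a :=
  mp (b := .imp a a) (QDerivable.ax_k _ _) (QDerivable.ax_k _ _)

theorem trans (h₁ : Entails Ax a b) (h₂ : Entails Ax b c) : Entails Ax a c :=
  mp (of_derivable h₂) h₁

theorem and_left (a b : QFormula Pred) : Entails Ax (.and a b) a := QDerivable.and_left _ _

theorem and_right (a b : QFormula Pred) : Entails Ax (.and a b) b := QDerivable.and_right _ _

theorem and_intro (h₁ : Entails Ax a b) (h₂ : Entails Ax a c) : Entails Ax a (.and b c) :=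
  mp (h₁.trans (QDerivable.and_intro b c)) h₂

theorem curry (h : Entails Ax (.and a b) c) : Entails Ax a (.imp b c) :=
  trans (QDerivable.and_intro a b) ((QDerivable.ax_s _ _ _).mp (of_derivable h))

theorem uncurry (h : Entails Ax a (.imp b c)) : Entails Ax (.and a b) c :=
  mp ((and_left a b).trans h) (and_right a b)

theorem swap (h : Entails Ax a (.imp b c)) : Entails Ax b (.imp a c) :=
  curry ((and_intro (and_right b a) (and_left b a)).trans h.uncurry)

theorem or_elim (h₁ : Entails Ax a c) (h₂ : Entails Ax b c) : Entails Ax (.or a b) c :=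
  ((QDerivable.or_elim _ _ _).mp h₁).mp h₂

theorem bot_elim (a : QFormula Pred) : Entails Ax .bot a := QDerivable.bot_elim _

theorem circ_mono (h : Entails Ax a b) : Entails Ax (.circ a) (.circ b) := QDerivable.circ_mono h

theorem circ_and (hAx : axiomsK Pred ⊆ Ax) (a b : QFormula Pred) :
    Entails Ax (.and (.circ a) (.circ b)) (.circ (.and a b)) :=
  uncurry ((circ_mono (QDerivable.and_intro a b)).trans
    (QDerivable.extra (hAx ⟨_, _, rfl⟩)))

end Entails

/-! ### Variables: renaming without capture -/

namespace QFormula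

variable {Pred : ℕ → Type u}

/-- The set of variables that are bound by some quantifier of the formula. -/
def bv : QFormula Pred → Finset ℕ
  | atom _ _ => ∅
  | bot => ∅
  | and φ ψ => φ.bv ∪ ψ.bv
  | or φ ψ => φ.bv ∪ ψ.bv
  | imp φ ψ => φ.bv ∪ ψ.bv
  | all n φ => insert n φ.bv
  | ex n φ => insert n φ.bv
  | circ φ => φ.bv

/-- Simultaneous replacement of every free variable `n` by `τ n`. Bound variables are kept, so this
is the intended substitution only if no `τ n` is captured. -/
def rename (τ : ℕ → ℕ) : QFormula Pred → QFormula Pred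
  | atom p t => atom p (fun i => τ (t i))
  | bot => bot
  | and φ ψ => and (rename τ φ) (rename τ ψ)
  | or φ ψ => or (rename τ φ) (rename τ ψ)
  | imp φ ψ => imp (rename τ φ) (rename τ ψ)
  | all n φ => all n (rename (Function.update τ n n) φ)
  | ex n φ => ex n (rename (Function.update τ n n) φ)
  | circ φ => circ (rename τ φ)

theorem bv_rename (τ : ℕ → ℕ) (φ : QFormula Pred) : (rename τ φ).bv = φ.bv := by
  induction φ generalizing τ <;> simp_all [rename, bv]

theorem rename_eq_self {τ : ℕ → ℕ} {φ : QFormula Pred} (h : ∀ n ∈ φ.fv, τ n = n) :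
    rename τ φ = φ := by
  induction φ generalizing τ with
  | atom p t =>
    have : (fun i => τ (t i)) = t := funext fun i => h _ (by simp [fv])
    simp only [rename, this]
  | bot => rfl
  | and φ ψ h₁ h₂ | or φ ψ h₁ h₂ | imp φ ψ h₁ h₂ =>
    simp only [fv, Finset.mem_union] at h
    simp only [rename, h₁ fun n hn => h n (Or.inl hn), h₂ fun n hn => h n (Or.inr hn)]
  | all n φ ih | ex n φ ih =>
    have : rename (Function.update τ n n) φ = φ := by
      refine ih fun m hm => ?_
      by_cases hmn : m = n
      · simp [hmn]
      · simp [hmn, h m (by simp [fv, hmn, hm])]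
    simp only [rename, this]
  | circ φ ih => simp only [rename, ih h]

theorem subst_rename {τ : ℕ → ℕ} {n : ℕ} (d : ℕ) {φ : QFormula Pred} (hn : τ n = n)
    (h : ∀ m, m ≠ n → τ m ≠ n) :
    subst d n (rename τ φ) = rename (Function.update τ n d) φ := by
  induction φ generalizing τ with
  | atom p t =>
    simp only [rename, subst, atom.injEq, heq_eq_eq, true_and]
    funext i
    by_cases hi : t i = n
    · simp [hi, hn]
    · simp [hi, h _ hi]
  | bot => rfl
  | and φ ψ h₁ h₂ | or φ ψ h₁ h₂ | imp φ ψ h₁ h₂ => simp only [rename, subst, h₁ hn h, h₂ hn h]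
  | all k φ ih | ex k φ ih =>
    by_cases hk : k = n
    · subst hk
      simp only [rename, subst, if_true, Function.update_idem]
    · simp only [rename, subst, hk, if_false]
      rw [ih, Function.update_comm hk]
      · rw [Function.update_of_ne (Ne.symm hk), hn]
      · intro m hm
        by_cases hmk : m = k
        · simpa [hmk] using hk
        · simpa [hmk] using h m hm
  | circ φ ih => simp only [rename, subst, ih hn h]

theorem freeFor_of_notMem_bv {t x : ℕ} {φ : QFormula Pred} (h : t ∉ φ.bv) : FreeFor t x φ := by
  induction φ with
  | atom | bot => trivial
  | and φ ψ h₁ h₂ | or φ ψ h₁ h₂ | imp φ ψ h₁ h₂ =>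
    simp only [bv, Finset.mem_union, not_or] at h
    exact ⟨h₁ h.1, h₂ h.2⟩
  | all n φ ih | ex n φ ih =>
    simp only [bv, Finset.mem_insert, not_or] at h
    exact Or.inr ⟨Ne.symm h.1, ih h.2⟩
  | circ φ ih => exact ih h

theorem subst_subst_of_fresh {d n : ℕ} {φ : QFormula Pred} (hf : d ∉ φ.fv) (hb : d ∉ φ.bv) :
    subst n d (subst d n φ) = φ := by
  induction φ with
  | atom p t =>
    simp only [fv, Finset.mem_image, Finset.mem_univ, true_and, not_exists] at hf
    simp only [subst, atom.injEq, heq_eq_eq, true_and]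
    funext i
    by_cases hi : t i = n <;> simp [hi, hf]
  | bot => rfl
  | and φ ψ h₁ h₂ | or φ ψ h₁ h₂ | imp φ ψ h₁ h₂ =>
    simp only [bv, fv, Finset.mem_union, not_or] at hf hb
    simp only [subst, h₁ hf.1 hb.1, h₂ hf.2 hb.2]
  | all k φ ih | ex k φ ih =>
    by_cases hk : k = n
    · subst hk
      rw [subst, if_pos rfl, subst_eq_self_of_notMem_fv hf]
    · simp only [bv, fv, Finset.mem_insert, Finset.mem_erase, not_or, not_and] at hf hb
      simp only [subst, hk, Ne.symm hb.1, if_false, ih (hf hb.1) hb.2]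
  | circ φ ih => simp only [subst, ih hf hb]

theorem freeFor_subst_of_fresh {d n : ℕ} {φ : QFormula Pred} (hf : d ∉ φ.fv) :
    FreeFor n d (subst d n φ) := by
  induction φ with
  | atom | bot => trivial
  | and φ ψ h₁ h₂ | or φ ψ h₁ h₂ | imp φ ψ h₁ h₂ =>
    simp only [fv, Finset.mem_union, not_or] at hf
    exact ⟨h₁ hf.1, h₂ hf.2⟩
  | all k φ ih | ex k φ ih =>
    by_cases hk : k = n
    · subst hk
      rw [subst, if_pos rfl]
      exact Or.inl hf
    · simp only [subst, hk, if_false]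
      by_cases hkd : k = d
      · left; simp [fv, hkd]
      · exact Or.inr ⟨hk, ih fun h => hf (by simp [fv, h, Ne.symm hkd])⟩
  | circ φ ih => exact ih hf

theorem notMem_fv_subst {d n : ℕ} {φ : QFormula Pred} (h : d ≠ n) : n ∉ (subst d n φ).fv := by
  induction φ with
  | atom p t =>
    simp only [subst, fv, Finset.mem_image, Finset.mem_univ, true_and, not_exists]
    intro i
    split_ifs with hi
    exacts [h, hi]
  | bot => simp [subst, fv]
  | and φ ψ h₁ h₂ | or φ ψ h₁ h₂ | imp φ ψ h₁ h₂ => simp [subst, fv, h₁, h₂]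
  | all k φ ih | ex k φ ih =>
    by_cases hk : k = n
    · simp [subst, fv, hk]
    · simp [subst, fv, hk, ih]
  | circ φ ih => exact ih

end QFormula

namespace Entails

open QFormula

variable {Pred : ℕ → Type u} {Ax : Set (QFormula Pred)}

/-- The Bernays rule for `∀` with the quantified variable exchanged for a fresh one. No general
renaming of bound variables is needed: substituting back a fresh variable restores `φ`. -/
theorem all_of_fresh {a φ : QFormula Pred} {d n : ℕ} (ha : d ∉ a.fv) (hf : d ∉ φ.fv)
    (hb : d ∉ φ.bv) (h : Entails Ax a (subst d n φ)) : Entails Ax a (.all n φ) := by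
  by_cases hdn : d = n
  · subst hdn
    rw [subst_self] at h
    exact QDerivable.bernays_all _ ha h
  · refine (show Entails Ax a (.all d (subst d n φ)) from QDerivable.bernays_all d ha h).trans ?_
    refine QDerivable.bernays_all n (by simp [fv, notMem_fv_subst hdn]) ?_
    have := QDerivable.all_inst (Ax := Ax) (subst d n φ) n d (freeFor_subst_of_fresh hf)
    rwa [subst_subst_of_fresh hf hb] at this

/-- The Bernays rule for `∃` with the quantified variable exchanged for a fresh one. -/
theorem ex_of_fresh {b φ : QFormula Pred} {d n : ℕ} (hfb : d ∉ b.fv) (hf : d ∉ φ.fv)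
    (hb : d ∉ φ.bv) (h : Entails Ax (subst d n φ) b) : Entails Ax (.ex n φ) b := by
  by_cases hdn : d = n
  · subst hdn
    rw [subst_self] at h
    exact QDerivable.bernays_ex _ hfb h
  · refine trans ?_ (show Entails Ax (.ex d (subst d n φ)) b from QDerivable.bernays_ex d hfb h)
    refine QDerivable.bernays_ex n (by simp [fv, notMem_fv_subst hdn]) ?_
    have := QDerivable.ex_inst (Ax := Ax) (subst d n φ) n d (freeFor_subst_of_fresh hf)
    rwa [subst_subst_of_fresh hf hb] at this

end Entails

/-! ### Closed theories and the canonical cover system -/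

/-- A point of the canonical system, given as the set of the upper bounds of a cut in the
Lindenbaum preorder: `T` contains each formula that is entailed by every single formula `a` which
entails all of `T`. -/
@[ext]
structure CutTheory {Pred : ℕ → Type u} (Ax : Set (QFormula Pred)) where
  carrier : Set (QFormula Pred)
  closed : ∀ φ, (∀ a, (∀ ψ ∈ carrier, Entails Ax a ψ) → Entails Ax a φ) → φ ∈ carrier

namespace CutTheory

variable {Pred : ℕ → Type u} {Ax : Set (QFormula Pred)}

instance : Membership (QFormula Pred) (CutTheory Ax) := ⟨fun T φ => φ ∈ T.carrier⟩

instance : PartialOrder (CutTheory Ax) :=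
  PartialOrder.lift carrier fun _ _ => CutTheory.ext

/-- `T.LowerBound a`: the single formula `a` entails every member of `T`. The lower bounds of `T`
form the cut whose set of upper bounds is `T`. -/
def LowerBound (T : CutTheory Ax) (a : QFormula Pred) : Prop := ∀ ψ ∈ T, Entails Ax a ψ

variable {T U W : CutTheory Ax} {φ ψ a b : QFormula Pred}

theorem mem_iff : φ ∈ T ↔ ∀ a, T.LowerBound a → Entails Ax a φ :=
  ⟨fun h _ ha => ha φ h, T.closed φ⟩

theorem LowerBound.of_entails (h : T.LowerBound a) (hba : Entails Ax b a) : T.LowerBound b :=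
  fun ψ hψ => hba.trans (h ψ hψ)

theorem mem_of_entails (h : φ ∈ T) (hφψ : Entails Ax φ ψ) : ψ ∈ T :=
  mem_iff.2 fun _ ha => (ha φ h).trans hφψ

theorem mem_of_imp_mem (h : .imp φ ψ ∈ T) (hφ : φ ∈ T) : ψ ∈ T :=
  mem_iff.2 fun _ ha => (ha _ h).mp (ha _ hφ)

/-- The theory of the formulas that are entailed by each member of a set. -/
def ofSet (Ax : Set (QFormula Pred)) (A : Set (QFormula Pred)) : CutTheory Ax where
  carrier := {ψ | ∀ a ∈ A, Entails Ax a ψ}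
  closed _ h a ha := h a fun _ hψ => hψ a ha

theorem lowerBound_ofSet {A : Set (QFormula Pred)} (h : a ∈ A) : (ofSet Ax A).LowerBound a :=
  fun _ hψ => hψ a h

/-- The join of two theories. -/
def join (T U : CutTheory Ax) : CutTheory Ax := ofSet Ax {a | T.LowerBound a ∧ U.LowerBound a}

theorem le_join_left : T ≤ T.join U := fun _ hψ _ ha => ha.1 _ hψ

theorem le_join_right : U ≤ T.join U := fun _ hψ _ ha => ha.2 _ hψ

theorem lowerBound_join (ha : T.LowerBound a) (hb : U.LowerBound b) :
    (T.join U).LowerBound (.and a b) :=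
  lowerBound_ofSet ⟨ha.of_entails (.and_left a b), hb.of_entails (.and_right a b)⟩

/-- The least theory that contains `T` and `φ`. -/
def adjoin (T : CutTheory Ax) (φ : QFormula Pred) : CutTheory Ax where
  carrier := {χ | .imp φ χ ∈ T}
  closed _ h := mem_iff.2 fun _ ha => Entails.curry <| h _ fun _ hψ => (ha _ hψ).uncurry

theorem mem_adjoin : ψ ∈ T.adjoin φ ↔ .imp φ ψ ∈ T := Iff.rfl

theorem le_adjoin : T ≤ T.adjoin φ :=
  fun _ hψ => mem_of_entails (T := T) hψ (QDerivable.ax_k _ _)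

theorem self_mem_adjoin : φ ∈ T.adjoin φ :=
  mem_adjoin.2 <| mem_iff.2 fun _ _ => .of_derivable (Entails.refl φ)

/-- The intersection of a set of theories. -/
def inter (C : Set (CutTheory Ax)) : CutTheory Ax where
  carrier := {ψ | ∀ U ∈ C, ψ ∈ U}
  closed φ h U hU := U.closed φ fun a ha => h a fun ψ hψ => ha ψ (hψ U hU)

/-- The canonical accessibility relation. In the MacNeille completion, where `T` stands for the cut
of its lower bounds, it says that `T` lies below the join of all `○ a`, for `a` in the cut of `U`. -/
def Access (T U : CutTheory Ax) : Prop :=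
  ∀ ψ, (∀ a, U.LowerBound a → Entails Ax (.circ a) ψ) → ψ ∈ T

theorem access_refl (T : CutTheory Ax) : Access T T :=
  fun _ h => mem_iff.2 fun a ha => Entails.trans (QDerivable.circ_refl a) (h a ha)

/-- Strength of `○` gives the condition `PrenuclearCondition`. -/
theorem Access.join_left (h : Access T U) : Access T (T.join U) := by
  intro ψ hψ
  refine mem_iff.2 fun b hb => ?_
  -- It suffices that `b → ψ` belongs to `T`, as `b` entails `T`.
  have key : .imp b ψ ∈ T := by
    refine h _ fun a ha => Entails.swap (Entails.curry ?_)
    exact Entails.trans (QDerivable.circ_strength b a) (hψ _ (lowerBound_join hb ha))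
  exact (hb _ key).mp (.refl b)

/-- Multiplicativity of `○` makes successors directed. -/
theorem Access.join (hAx : axiomsK Pred ⊆ Ax) (hU : Access T U) (hW : Access T W) :
    Access T (U.join W) := by
  intro ψ hψ
  refine mem_iff.2 fun c hc => ?_
  have key : .imp c ψ ∈ T := by
    refine hW _ fun b hb => Entails.swap (hc _ (hU _ fun a ha => Entails.curry ?_))
    exact (Entails.circ_and hAx a b).trans (hψ _ (lowerBound_join ha hb))
  exact (hc _ key).mp (.refl c)

/-- Membership form of the truth condition for `○`. From right to left, the witness is the principal
theory of `φ`, so the least extension of `○` agrees with `○` on principal cuts. -/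
theorem exists_access_iff : (∃ U, φ ∈ U ∧ Access T U) ↔ .circ φ ∈ T := by
  constructor
  · rintro ⟨U, hφ, h⟩
    exact h _ fun a ha => Entails.circ_mono (ha φ hφ)
  · intro h
    exact ⟨ofSet Ax {φ}, fun a ha => ha ▸ .refl a, fun ψ hψ =>
      mem_of_entails h (hψ φ (lowerBound_ofSet rfl))⟩

/-- Every refinement `U` of a theory covered by `C` is covered by the joins of `U` with the members
of `C`: the points satisfy the frame distributive law. -/
theorem mem_of_forall_mem_join {C : Set (CutTheory Ax)} (hTU : T ≤ U)
    (hC : ∀ ψ, (∀ c ∈ C, ψ ∈ c) → ψ ∈ T) (h : ∀ c ∈ C, ψ ∈ c.join U) : ψ ∈ U := by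
  refine mem_iff.2 fun b hb => ?_
  have key : .imp b ψ ∈ U := hTU <| hC _ fun c hc => mem_iff.2 fun a ha =>
    Entails.curry (lowerBound_join ha hb _ (h c hc))
  exact (hb _ key).mp (.refl b)

variable (Ax) in
/-- The canonical modal cover system: `T` is covered by `C` if `T` is the intersection of `C`. -/
def canonicalSystem : ModalCoverSystem (CutTheory Ax) where
  covers T C := ∀ ψ, ψ ∈ T ↔ ∀ U ∈ C, ψ ∈ U
  existence T := ⟨{T}, by simp, by simp⟩
  transitivity T C E hC hE ψ := by
    rw [hC ψ]
    simp only [Set.mem_iUnion, exists_prop]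
    constructor
    · rintro h U ⟨c, hc, hU⟩
      exact (hE c hc ψ).1 (h c hc) U hU
    · exact fun h c hc => (hE c hc ψ).2 fun U hU => h U ⟨c, hc, hU⟩
  refinement T U C hTU hC := by
    refine ⟨(fun c => c.join U) '' C, fun ψ => ?_, ?_⟩
    · rw [Set.forall_mem_image]
      exact ⟨fun h c _ => le_join_right h, fun h =>
        mem_of_forall_mem_join hTU (fun χ => (hC χ).2) fun c hc => h hc⟩
    · rintro _ ⟨c, hc, rfl⟩
      exact ⟨c, hc, le_join_left⟩
  strictlyLocalic T C hC U hU ψ hψ := (hC ψ).1 hψ U hU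
  R := Access
  confluence T T' U hTT' h := ⟨U, fun ψ hψ => hTT' (h ψ hψ), le_rfl⟩
  modal_localisation := by
    rintro T A ⟨C, hC, hCA⟩
    choose! F hFA hF using hCA
    refine ⟨inter (F '' C), fun ψ hψ => (hC ψ).2 fun c hc => ?_, F '' C, fun _ => Iff.rfl, ?_⟩
    -- A lower bound of the larger theory `F c` is one of the intersection.
    · refine hF hc ψ fun a ha => hψ a fun χ hχ => ha χ (hχ _ ⟨c, hc, rfl⟩)
    · rintro _ ⟨c, hc, rfl⟩
      exact hFA hc

theorem covers_empty_iff : (canonicalSystem Ax).covers T ∅ ↔ .bot ∈ T := by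
  simp only [canonicalSystem, Set.mem_empty_iff_false, false_imp_iff, implies_true, iff_true]
  exact ⟨fun h => h _, fun h ψ => mem_of_entails h (.bot_elim ψ)⟩

theorem isPrenuclear_canonicalSystem : (canonicalSystem Ax).IsPrenuclear :=
  ⟨access_refl, fun _ _ h => ⟨_, le_join_right, le_join_left, h.join_left⟩⟩

theorem isMultiplicativePrenuclear_canonicalSystem (hAx : axiomsK Pred ⊆ Ax) :
    (canonicalSystem Ax).IsMultiplicativePrenuclear :=
  ⟨fun T => ⟨T, access_refl T⟩,
    fun _ _ _ hU hW => ⟨_, le_join_left, le_join_right, hU.join hAx hW⟩,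
    isPrenuclear_canonicalSystem.2⟩

theorem isIEL_canonicalSystem (hAx : axiomsK Pred ⊆ Ax)
    (hbot : QFormula.neg (.circ .bot) ∈ Ax) : (canonicalSystem Ax).IsIEL := by
  refine ⟨isMultiplicativePrenuclear_canonicalSystem hAx, fun T U h hU => ?_⟩
  rw [covers_empty_iff] at hU ⊢
  exact h _ fun a ha => (Entails.circ_mono (ha _ hU)).trans (QDerivable.extra hbot)

end CutTheory

theorem IELLogic.isCoverSystemFor_canonicalSystem (Pred : ℕ → Type u) (L : IELLogic) :
    L.IsCoverSystemFor (CutTheory.canonicalSystem (L.extraAxioms Pred)) := by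
  cases L with
  | IELmm => exact CutTheory.isPrenuclear_canonicalSystem
  | IELm => exact CutTheory.isMultiplicativePrenuclear_canonicalSystem subset_rfl
  | IEL =>
    exact CutTheory.isIEL_canonicalSystem Set.subset_union_left (Or.inr rfl)

/-! ### The canonical model and the truth lemma -/

namespace CutTheory

open QFormula

variable {Pred : ℕ → Type u} {Ax : Set (QFormula Pred)}

variable (Ax) in
/-- The canonical valuation. The individuals are the natural numbers, and `d` stands for the
variable with index `d + N`. -/
def canonicalValuation (N : ℕ) :
    CoverValuation Pred (canonicalSystem Ax).toCoverSystem ℕ where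
  val p a := {T | atom p (fun i => a i + N) ∈ T}
  isProposition p a := by
    refine ⟨fun T U hTU h => hTU h, ?_⟩
    rintro T ⟨C, hC, hCX⟩
    exact (hC _).2 fun U hU => hCX hU

theorem exists_fresh (N : ℕ) (s : Finset ℕ) : ∃ d, d + N ∉ s :=
  ⟨s.sup id + 1, fun h => by
    have := Finset.le_sup (f := id) h
    simp only [id] at this
    omega⟩

/-- Under an assignment of individuals `d` (the variables `d + N`), a quantifier over a variable
`n < N` is instantiated by the substitution of `d + N` for `n`. -/
theorem subst_rename_add {N n : ℕ} (hn : n < N) (σ : ℕ → ℕ) (d : ℕ) (φ : QFormula Pred) :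
    subst (d + N) n (rename (Function.update (fun m => σ m + N) n n) φ) =
      rename (fun m => Function.update σ n d m + N) φ := by
  rw [subst_rename _ (by simp) fun m hm => by simp only [Function.update_of_ne hm]; omega,
    Function.update_idem]
  congr 1
  funext m
  by_cases hm : m = n <;> simp [hm]

/-- The truth lemma for formulas with bound variables below `N`. A point forces such a formula if and
only if it contains the formula with the assigned individuals substituted. -/
theorem canonical_forces_iff {N : ℕ} {φ : QFormula Pred} (hN : ∀ n ∈ φ.bv, n < N)
    {σ : ℕ → ℕ} {T : CutTheory Ax} :
    CoverForces (canonicalSystem Ax) (canonicalValuation Ax N) σ T φ ↔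
      rename (fun m => σ m + N) φ ∈ T := by
  induction φ generalizing σ T with
  | atom p t => rfl
  | bot => exact covers_empty_iff
  | and φ ψ h₁ h₂ =>
    simp only [bv, Finset.mem_union] at hN
    simp only [CoverForces, h₁ fun n hn => hN n (Or.inl hn), h₂ fun n hn => hN n (Or.inr hn),
      rename]
    exact ⟨fun h => mem_iff.2 fun a ha => (ha _ h.1).and_intro (ha _ h.2), fun h =>
      ⟨mem_of_entails h (.and_left _ _), mem_of_entails h (.and_right _ _)⟩⟩
  | or φ ψ h₁ h₂ =>
    simp only [bv, Finset.mem_union] at hN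
    simp only [CoverForces, h₁ fun n hn => hN n (Or.inl hn), h₂ fun n hn => hN n (Or.inr hn),
      rename]
    constructor
    · rintro ⟨C, hC, h⟩
      refine (hC _).2 fun U hU => ?_
      rcases h U hU with h | h
      · exact mem_of_entails h (QDerivable.or_left _ _)
      · exact mem_of_entails h (QDerivable.or_right _ _)
    · intro h
      refine ⟨{T.adjoin (rename (fun m => σ m + N) φ), T.adjoin (rename (fun m => σ m + N) ψ)},
        fun χ => ?_, ?_⟩
      · simp only [Set.mem_insert_iff, Set.mem_singleton_iff, forall_eq_or_imp, forall_eq]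
        refine ⟨fun hχ => ⟨le_adjoin hχ, le_adjoin hχ⟩, fun hχ => mem_iff.2 fun a ha => ?_⟩
        have := Entails.or_elim (ha _ hχ.1).swap (ha _ hχ.2).swap
        exact ((ha _ h).trans this).mp (.refl a)
      · rintro _ (rfl | rfl)
        exacts [Or.inl self_mem_adjoin, Or.inr self_mem_adjoin]
  | imp φ ψ h₁ h₂ =>
    simp only [bv, Finset.mem_union] at hN
    simp only [CoverForces, h₁ fun n hn => hN n (Or.inl hn), h₂ fun n hn => hN n (Or.inr hn),
      rename]
    exact ⟨fun h => h _ le_adjoin self_mem_adjoin, fun h U hTU hU =>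
      mem_of_imp_mem (hTU h) hU⟩
  | all n φ ih =>
    simp only [bv, Finset.mem_insert, forall_eq_or_imp] at hN
    simp only [CoverForces, ih hN.2, rename, ← subst_rename_add hN.1]
    set φ' := rename (Function.update (fun m => σ m + N) n n) φ with hφ'
    constructor
    · refine fun h => mem_iff.2 fun a ha => ?_
      obtain ⟨d, hd⟩ := exists_fresh N (a.fv ∪ φ'.fv ∪ φ'.bv)
      simp only [Finset.mem_union, not_or] at hd
      exact Entails.all_of_fresh hd.1.1 hd.1.2 hd.2 (ha _ (h d))
    · refine fun h d => mem_of_entails h (QDerivable.all_inst _ _ _ (freeFor_of_notMem_bv ?_))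
      rw [hφ', bv_rename]
      exact fun hd => by have := hN.2 _ hd; omega
  | ex n φ ih =>
    simp only [bv, Finset.mem_insert, forall_eq_or_imp] at hN
    simp only [CoverForces, ih hN.2, rename, ← subst_rename_add hN.1]
    set φ' := rename (Function.update (fun m => σ m + N) n n) φ with hφ'
    constructor
    · rintro ⟨C, hC, h⟩
      refine (hC _).2 fun U hU => ?_
      obtain ⟨d, hd⟩ := h U hU
      refine mem_of_entails hd (QDerivable.ex_inst _ _ _ (freeFor_of_notMem_bv ?_))
      rw [hφ', bv_rename]
      exact fun hd => by have := hN.2 _ hd; omega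
    · intro h
      refine ⟨Set.range fun d => T.adjoin (subst (d + N) n φ'), fun χ => ?_, ?_⟩
      · rw [Set.forall_mem_range]
        refine ⟨fun hχ d => le_adjoin hχ, fun hχ => mem_iff.2 fun a ha => ?_⟩
        obtain ⟨d, hd⟩ := exists_fresh N ((imp a χ).fv ∪ φ'.fv ∪ φ'.bv)
        simp only [Finset.mem_union, not_or] at hd
        have := Entails.ex_of_fresh hd.1.1 hd.1.2 hd.2 (ha _ (hχ d)).swap
        exact ((ha _ h).trans this).mp (.refl a)
      · rintro _ ⟨d, rfl⟩
        exact ⟨d, self_mem_adjoin⟩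
  | circ φ ih =>
    rw [rename, ← exists_access_iff]
    exact exists_congr fun U => and_congr_left' (ih hN)

end CutTheory

/-! ### Universal closure and completeness -/

namespace QFormula

variable {Pred : ℕ → Type u}

/-- Universal quantification of the variables `0, …, N - 1`. -/
def allBelow : ℕ → QFormula Pred → QFormula Pred
  | 0, φ => φ
  | N + 1, φ => allBelow N (all N φ)

theorem fv_allBelow (N : ℕ) (φ : QFormula Pred) : ∀ n ∈ (allBelow N φ).fv, n ∈ φ.fv ∧ N ≤ n := by
  induction N generalizing φ with
  | zero => simp [allBelow]
  | succ N ih =>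
    intro n hn
    have := ih _ n hn
    simp only [fv, Finset.mem_erase] at this
    exact ⟨this.1.2, by omega⟩

end QFormula

theorem QDerivable.of_allBelow {Pred : ℕ → Type u} {Ax : Set (QFormula Pred)} {N : ℕ}
    {φ : QFormula Pred} (h : QDerivable Ax (QFormula.allBelow N φ)) : QDerivable Ax φ := by
  induction N generalizing φ with
  | zero => exact h
  | succ N ih =>
    have := QDerivable.all_inst (Ax := Ax) φ N N (QFormula.freeFor_self N φ)
    rw [QFormula.subst_self] at this
    exact this.mp (ih h)

theorem forces_allBelow {Pred : ℕ → Type u} {S : Type v} [PartialOrder S]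
    (ℳ : ModalCoverSystem S) {D : Type w} (V : CoverValuation Pred ℳ.toCoverSystem D)
    {φ : QFormula Pred} (h : ∀ σ x, CoverForces ℳ V σ x φ) (N : ℕ) (σ : ℕ → D) (x : S) :
    CoverForces ℳ V σ x (φ.allBelow N) := by
  induction N generalizing φ with
  | zero => exact h σ x
  | succ N ih => exact ih fun τ y d => h _ y

theorem IELLogic.CoverValid.qProvable {Pred : ℕ → Type u} {L : IELLogic} {φ : QFormula Pred}
    (h : IELLogic.CoverValid.{u, u, 0} L φ) : L.QProvable φ := by
  set ψ := φ.allBelow (φ.fv.sup id + 1) with hψ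
  have hfv : ∀ n, n ∉ ψ.fv := fun n hn => by
    obtain ⟨h₁, h₂⟩ := QFormula.fv_allBelow _ _ n hn
    have := Finset.le_sup (f := id) h₁
    simp only [id] at this
    omega
  set N := ψ.bv.sup id + 1
  have hN : ∀ n ∈ ψ.bv, n < N := fun n hn => Nat.lt_succ_of_le (Finset.le_sup (f := id) hn)
  -- The least theory consists of the formulas entailed by every formula, that is, of the theorems.
  have hforces := forces_allBelow _
    (CutTheory.canonicalValuation (L.extraAxioms Pred) N)
    (h _ _ (L.isCoverSystemFor_canonicalSystem Pred) ℕ _) (φ.fv.sup id + 1) id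
    (CutTheory.ofSet _ Set.univ)
  rw [CutTheory.canonical_forces_iff hN,
    QFormula.rename_eq_self fun n hn => absurd hn (hfv n)] at hforces
  have : QDerivable (L.extraAxioms Pred) ψ :=
    QDerivable.mp (hforces (.imp .bot .bot) trivial) (QDerivable.bot_elim _)
  exact this.of_allBelow

/-- Soundness and completeness of `QIEL⁻₋`, `QIEL⁻` and `QIEL` with respect to their cover
systems. Soundness is for models of every size; for completeness already the models whose points
are in the universe of the signature and whose individuals are in `Type` suffice. -/
theorem mainTheorem1 {Pred : ℕ → Type u} (L : IELLogic) (φ : QFormula Pred) :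
    (L.QProvable φ → IELLogic.CoverValid.{u, v, w} L φ) ∧
      (IELLogic.CoverValid.{u, u, 0} L φ → L.QProvable φ) :=
  ⟨fun h => h.coverValid, fun h => h.qProvable⟩
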